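/- Let $K$ be an infinite field and let $\Lambda$ be a finite dimensional hereditary $K$-algebra. Let $S_1,\dots,S_n$ be representatives of the isomorphism classes of simple $\Lambda$-modules, and let $P_i$ be the projective cover of $S_i$. For a finitely generated $\Lambda$-module $M$ let $\underline{\dim}\, M\in\mathbb{N}^n$ be the vector whose $i$-th coordinate is the dimension of $\operatorname{Hom}_\Lambda(P_i,M)$ over the division algebra $\operatorname{End}_\Lambda(P_i)$. For $\alpha\in\mathbb{N}^n$ put $P(\alpha)=\bigoplus_i P_i^{\alpha_i}$. Let $d_{ji}$ be the dimension of $\operatorname{Ext}^1_\Lambda(S_j,S_i)$ over $\operatorname{End}_\Lambda(S_i)$, and let $\varphi_j:\bigoplus_i P_i^{d_{ji}}\to\operatorname{rad}P_j$ $(1\le j\le n)$ be any choice of isomorphisms, with induced isomorphism $\varphi_\alpha=\bigoplus_j\varphi_j^{\alpha_j}:\bigoplus_{i,j}P_i^{\alpha_jd_{ji}}\to\operatorname{rad}P(\alpha)$. Let $$H(\Lambda,\alpha)=\prod_i\operatorname{Hom}_\Lambda\Big(\bigoplus_jP_i^{\alpha_jd_{ji}},\,P_i^{\alpha_i}\Big)\subseteq\operatorname{Hom}_\Lambda\Big(\bigoplus_{i,j}P_i^{\alpha_jd_{ji}},\,P(\alpha)\Big),$$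 $$\operatorname{Rep}(\Lambda,\alpha)=\{f\in\operatorname{Hom}_\Lambda(\operatorname{rad}P(\alpha),P(\alpha)) : f\circ\varphi_\alpha\in H(\Lambda,\alpha)\},$$ a finite dimensional $K$-vector space with its Zariski topology, and for $f\in\operatorname{Rep}(\Lambda,\alpha)$ let $N_f$ be the cokernel of $f-\mathrm{inc}:\operatorname{rad}P(\alpha)\to P(\alpha)$, where $\mathrm{inc}$ is the inclusion. Suppose that $M$ is a finitely generated $\Lambda$-module with $\operatorname{Ext}^1_\Lambda(M,M)=0$ (that is, $M$ is rigid) and $\underline{\dim}\,M=\alpha$. Then $$\{f\in\operatorname{Rep}(\Lambda,\alpha) : N_f\cong M\}$$ is open and dense in $\operatorname{Rep}(\Lambda,\alpha)$. In particular the generic representation is determined by $\alpha$ up to isomorphism: every $\Lambda$-module $N$ for which $\{f\in\operatorname{Rep}(\Lambda,\alpha): N_f\cong N\}$ is open and dense is isomorphic to $M$, and so is every finitely generated rigid $\Lambda$-module $N$ with $\underline{\dim}\,N=\alpha$. -/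

import Mathlib

open scoped Topology

universe u v

/-- A ring is (left) hereditary if all its left ideals are projective. -/
def IsHereditaryRing (Λ : Type u) [Ring Λ] : Prop :=
  ∀ I : Ideal Λ, Module.Projective Λ I

section Ext

open CategoryTheory CategoryTheory.Abelian

/-- `Ext¹_Λ(M, N)`, computed in the category of all left `Λ`-modules. -/
abbrev ExtOne (Λ : Type u) [Ring Λ] (M N : Type u) [AddCommGroup M] [Module Λ M]
    [AddCommGroup N] [Module Λ N] : Type u :=
  Ext (ModuleCat.of Λ M) (ModuleCat.of Λ N) 1

/-- The action of `End_Λ(N)` on `Ext¹_Λ(M, N)` by functoriality in `N`. -/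
noncomputable instance ExtOne.moduleEnd (Λ : Type u) [Ring Λ] (M N : Type u)
    [AddCommGroup M] [Module Λ M] [AddCommGroup N] [Module Λ N] :
    Module (Module.End Λ N) (ExtOne Λ M N) where
  smul f x := x.comp (Ext.mk₀ (ModuleCat.ofHom f)) (add_zero 1)
  one_smul x := Ext.comp_mk₀_id x
  mul_smul f g x := by
    change x.comp (Ext.mk₀ (ModuleCat.ofHom g ≫ ModuleCat.ofHom f)) _ =
      (x.comp (Ext.mk₀ (ModuleCat.ofHom g)) _).comp (Ext.mk₀ (ModuleCat.ofHom f)) _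
    rw [← Ext.mk₀_comp_mk₀, Ext.comp_assoc_of_third_deg_zero]
  smul_zero f := Ext.zero_comp _ _ _ _ _
  smul_add f x y := Ext.add_comp _ _ _ _
  add_smul f g x := by
    change x.comp (Ext.mk₀ (ModuleCat.ofHom f + ModuleCat.ofHom g)) _ = _
    rw [Ext.mk₀_add, Ext.comp_add]
    rfl
  zero_smul x := by
    change x.comp (Ext.mk₀ (0 : ModuleCat.of Λ N ⟶ ModuleCat.of Λ N)) _ = _
    rw [Ext.mk₀_zero, Ext.comp_zero]

end Ext

/-- `M` is rigid: `Ext¹_Λ(M, M) = 0`. -/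
def IsRigid (Λ : Type u) [Ring Λ] (M : Type u) [AddCommGroup M] [Module Λ M] : Prop :=
  Subsingleton (ExtOne Λ M M)

/-- `S₁, …, Sₙ` is a list of the simple `Λ`-modules, each isomorphism class occurring once. -/
structure IsCompleteListOfSimples (Λ : Type u) [Ring Λ] {n : ℕ} (S : Fin n → Type u)
    [∀ i, AddCommGroup (S i)] [∀ i, Module Λ (S i)] : Prop where
  simple : ∀ i, IsSimpleModule Λ (S i)
  eq_of_iso : ∀ i j, Nonempty (S i ≃ₗ[Λ] S j) → i = j
  exhaustive : ∀ (T : Type u) [AddCommGroup T] [Module Λ T], IsSimpleModule Λ T →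
    ∃ i, Nonempty (T ≃ₗ[Λ] S i)

/-- `π : P → S` is a projective cover: `P` is projective and `π` is an epimorphism with
superfluous kernel. -/
structure IsProjectiveCover {Λ : Type u} [Ring Λ] {P S : Type u} [AddCommGroup P] [Module Λ P]
    [AddCommGroup S] [Module Λ S] (π : P →ₗ[Λ] S) : Prop where
  projective : Module.Projective Λ P
  surjective : Function.Surjective π
  superfluous : ∀ N : Submodule Λ P, N ⊔ LinearMap.ker π = ⊤ → N = ⊤

/-- The dimension vector of `M`: its `i`-th coordinate is the dimension of `Hom_Λ(P_i, M)` over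
`F_i = End_Λ(P_i)`, which acts on the right, by precomposition. -/
noncomputable def dimVector (Λ : Type u) [Ring Λ] {n : ℕ} (P : Fin n → Type u)
    [∀ i, AddCommGroup (P i)] [∀ i, Module Λ (P i)]
    (M : Type u) [AddCommGroup M] [Module Λ M] : Fin n → ℕ :=
  fun i => Module.finrank (Module.End Λ (P i))ᵈᵐᵃ (P i →ₗ[Λ] M)

/-- `d_{ji}`, the dimension of `Ext¹_Λ(S_j, S_i)` over `F_i = End_Λ(S_i)`. -/
noncomputable def extDim (Λ : Type u) [Ring Λ] {n : ℕ} (S : Fin n → Type u)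
    [∀ i, AddCommGroup (S i)] [∀ i, Module Λ (S i)] (j i : Fin n) : ℕ :=
  Module.finrank (Module.End Λ (S i)) (ExtOne Λ (S j) (S i))

/-- `P(α) = ⨁ᵢ Pᵢ^{αᵢ}`. -/
abbrev ProjSum {n : ℕ} (P : Fin n → Type u) (α : Fin n → ℕ) : Type u :=
  (i : Fin n) → Fin (α i) → P i

/-- `⨁ⱼ (⨁ᵢ Pᵢ^{d_{ji}})^{αⱼ}`. -/
abbrev RadSum {n : ℕ} (P : Fin n → Type u) (d : Fin n → Fin n → ℕ) (α : Fin n → ℕ) : Type u :=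
  (j : Fin n) → Fin (α j) → (i : Fin n) → Fin (d j i) → P i

/-- The `i`-th part `⨁ⱼ Pᵢ^{αⱼ d_{ji}}` of `⨁_{i,j} Pᵢ^{αⱼ d_{ji}}`. -/
abbrev RadSumPart {n : ℕ} (P : Fin n → Type u) (d : Fin n → Fin n → ℕ) (α : Fin n → ℕ)
    (i : Fin n) : Type u :=
  (j : Fin n) → Fin (α j) → Fin (d j i) → P i

/-- The radical of a finite direct sum is the direct sum of the radicals. -/
theorem mem_jacobson_pi_iff (Λ : Type u) [Ring Λ] {ι : Type*} [Finite ι] (M : ι → Type*)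
    [∀ i, AddCommGroup (M i)] [∀ i, Module Λ (M i)] (x : (i : ι) → M i) :
    x ∈ Module.jacobson Λ ((i : ι) → M i) ↔ ∀ i, x i ∈ Module.jacobson Λ (M i) := by
  classical
  have := Fintype.ofFinite ι
  refine ⟨fun h i => Module.jacobson_pi_le Λ M h i trivial, fun h => ?_⟩
  rw [← Finset.univ_sum_single x]
  exact Submodule.sum_mem _ fun i _ =>
    Module.le_comap_jacobson (LinearMap.single Λ M i) (h i)

section Rep

variable (K : Type v) (Λ : Type u) [Field K] [Ring Λ] [Algebra K Λ] {n : ℕ}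
  (P : Fin n → Type u) [∀ i, AddCommGroup (P i)] [∀ i, Module Λ (P i)]
  [∀ i, Module K (P i)] [∀ i, IsScalarTower K Λ (P i)]
  (d : Fin n → Fin n → ℕ) (α : Fin n → ℕ)

/-- The radical of `P(α)`. -/
abbrev radProjSum : Submodule Λ (ProjSum P α) :=
  Module.jacobson Λ (ProjSum P α)

variable {Λ P d} in
/-- The isomorphism `φ_α = ⨁ⱼ φⱼ^{αⱼ}` from `⨁_{i,j} Pᵢ^{αⱼ d_{ji}}` to `rad P(α)` given by
isomorphisms `φⱼ : ⨁ᵢ Pᵢ^{d_{ji}} ≅ rad Pⱼ`. -/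
def radIso (φ : (j : Fin n) → ((i : Fin n) → Fin (d j i) → P i) ≃ₗ[Λ] Module.jacobson Λ (P j)) :
    RadSum P d α ≃ₗ[Λ] radProjSum Λ P α where
  toFun x := ⟨fun j a => φ j (x j a), (mem_jacobson_pi_iff Λ _ _).2 fun j =>
    (mem_jacobson_pi_iff Λ _ _).2 fun a => (φ j (x j a)).2⟩
  invFun y j a := (φ j).symm ⟨y.1 j a,
    (mem_jacobson_pi_iff Λ _ _).1 ((mem_jacobson_pi_iff Λ _ _).1 y.2 j) a⟩
  map_add' x y := by ext j a; simp
  map_smul' c x := by ext j a; simp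
  left_inv x := by ext j a; simp
  right_inv y := by ext j a; simp

/-- The inclusion of `∏ᵢ Hom_Λ(⨁ⱼ Pᵢ^{αⱼ d_{ji}}, Pᵢ^{αᵢ})` in
`Hom_Λ(⨁_{i,j} Pᵢ^{αⱼ d_{ji}}, P(α))` as the space of block diagonal maps. -/
def blockDiagonal :
    ((i : Fin n) → RadSumPart P d α i →ₗ[Λ] (Fin (α i) → P i)) →ₗ[K]
      (RadSum P d α →ₗ[Λ] ProjSum P α) where
  toFun g :=
    { toFun := fun x i => g i (fun j a => x j a i)
      map_add' := fun x y => funext fun i =>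
        (g i).map_add (fun j a => x j a i) (fun j a => y j a i)
      map_smul' := fun c x => funext fun i => (g i).map_smul c (fun j a => x j a i) }
  map_add' _ _ := rfl
  map_smul' _ _ := rfl

/-- `H(Λ, α)`, the block diagonal homomorphisms. -/
def blockHom : Submodule K (RadSum P d α →ₗ[Λ] ProjSum P α) :=
  LinearMap.range (blockDiagonal K Λ P d α)

variable {Λ P d} in
/-- The representation space
`Rep_φ(Λ, α) = {f : rad P(α) → P(α) | f ∘ φ_α ∈ H(Λ, α)}`. -/
def repSpace
    (φ : (j : Fin n) → ((i : Fin n) → Fin (d j i) → P i) ≃ₗ[Λ] Module.jacobson Λ (P j)) :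
    Submodule K (radProjSum Λ P α →ₗ[Λ] ProjSum P α) where
  carrier := {f | f ∘ₗ (radIso α φ).toLinearMap ∈ blockHom K Λ P d α}
  add_mem' hf hg := (blockHom K Λ P d α).add_mem hf hg
  zero_mem' := (blockHom K Λ P d α).zero_mem
  smul_mem' c _ hf := (blockHom K Λ P d α).smul_mem c hf

variable {Λ P α} in
/-- `N_f = coker (f - inc : rad P(α) → P(α))`. -/
abbrev repCoker (f : radProjSum Λ P α →ₗ[Λ] ProjSum P α) : Type u :=
  ProjSum P α ⧸ LinearMap.range (f - (radProjSum Λ P α).subtype)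

variable {Λ P d α} in
/-- The set of points `f` of `Rep_φ(Λ, α)` with `N_f ≅ M`. -/
def isoLocus
    (φ : (j : Fin n) → ((i : Fin n) → Fin (d j i) → P i) ≃ₗ[Λ] Module.jacobson Λ (P j))
    (M : Type u) [AddCommGroup M] [Module Λ M] : Set (repSpace K α φ) :=
  {f | Nonempty (repCoker f.1 ≃ₗ[Λ] M)}

end Rep

section Zariski

variable (K : Type*) (V : Type*) [Field K] [AddCommGroup V] [Module K V]

/-- The algebra of polynomial functions on a vector space, generated by the linear forms. -/
def polyFunctions : Subalgebra K (V → K) :=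
  Algebra.adjoin K (Set.range fun l : Module.Dual K V => (l : V → K))

/-- The Zariski topology on (the `K`-points of) a finite dimensional vector space, viewed as an
affine space: it is generated by the nonvanishing sets of the polynomial functions. -/
abbrev zariskiTopology : TopologicalSpace V :=
  TopologicalSpace.generateFrom
    {U | ∃ p ∈ polyFunctions K V, U = {x | p x ≠ 0}}

end Zariski

/-!
If `N_e ≅ M`, the vanishing of `Ext¹(M, M)` makes `u ↦ u ∘ (e - inc)` surjective onto
`Hom(rad P(α), M)`, so by Cramer's rule the projection `P(α) → N_e ≅ M` extends to a polynomial
family of maps `P(α) → M` killing the image of `f - inc` for all `f`. The map in the family at `f`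
induces `N_f ≅ M` as soon as it is surjective, because `f - inc` is injective and so `N_f` has
constant dimension. This is an open condition, and nonempty open subsets of an affine space over an
infinite field are dense.

Some `N_f` is isomorphic to `M`: since `End(Pᵢ)` is a division ring, `P(α)` has a map `p` to `M`
for which `Hom(Pᵢ, Pᵢ^{αᵢ}) → Hom(Pᵢ, M)` is bijective for all `i`. Its surjectivity gives a block
diagonal `f` with `p ∘ f = p ∘ inc`. The induced map `N_f → M` is an isomorphism because `f - inc`
allows every map `Pᵢ → P(α)` to be moved into the block `Pᵢ^{αᵢ}`.
-/

section PolynomialMaps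

variable {K V W X : Type*} [Field K] [AddCommGroup V] [Module K V] [AddCommGroup W] [Module K W]
  [AddCommGroup X] [Module K X]

/-- Polynomial maps between vector spaces: all linear forms pull back to polynomial functions. This
avoids a choice of bases, and for infinite dimensional `W` it is the weak notion. -/
def IsPolynomialMap (K : Type*) {V W : Type*} [Field K] [AddCommGroup V] [Module K V]
    [AddCommGroup W] [Module K W] (w : V → W) : Prop :=
  ∀ l : Module.Dual K W, (fun x => l (w x)) ∈ polyFunctions K V

namespace IsPolynomialMap

theorem const (c : W) : IsPolynomialMap K fun _ : V => c :=
  fun l => (polyFunctions K V).algebraMap_mem (l c)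

theorem of_linearMap (L : V →ₗ[K] W) : IsPolynomialMap K L :=
  fun l => Algebra.subset_adjoin ⟨l ∘ₗ L, rfl⟩

theorem sub {w z : V → W} (hw : IsPolynomialMap K w) (hz : IsPolynomialMap K z) :
    IsPolynomialMap K fun x => w x - z x := fun l => by
  simp only [map_sub]
  exact sub_mem (hw l) (hz l)

theorem smul {p : V → K} (hp : p ∈ polyFunctions K V) {w : V → W} (hw : IsPolynomialMap K w) :
    IsPolynomialMap K fun x => p x • w x := fun l => by
  simp only [map_smul]
  exact mul_mem hp (hw l)

theorem sum {ι : Type*} {s : Finset ι} {w : ι → V → W}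
    (hw : ∀ i ∈ s, IsPolynomialMap K (w i)) : IsPolynomialMap K fun x => ∑ i ∈ s, w i x :=
  fun l => by
  have : (fun x => l (∑ i ∈ s, w i x)) = ∑ i ∈ s, fun x => l (w i x) := by
    ext x
    simp only [map_sum, Finset.sum_apply]
  exact this ▸ sum_mem fun i hi => hw i hi l

theorem linearMap_comp (L : W →ₗ[K] X) {w : V → W} (hw : IsPolynomialMap K w) :
    IsPolynomialMap K fun x => L (w x) :=
  fun l => hw (l ∘ₗ L)

theorem comp_mem_polyFunctions {p : W → K} (hp : p ∈ polyFunctions K W) {w : V → W}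
    (hw : IsPolynomialMap K w) : (fun x => p (w x)) ∈ polyFunctions K V := by
  induction hp using Algebra.adjoin_induction with
  | mem p hp => obtain ⟨l, rfl⟩ := hp; exact hw l
  | algebraMap c => exact (polyFunctions K V).algebraMap_mem c
  | add p q _ _ hp hq => exact add_mem hp hq
  | mul p q _ _ hp hq => exact mul_mem hp hq

end IsPolynomialMap

section Determinants

variable {ι : Type*} [Fintype ι] [DecidableEq ι]

theorem matrix_det_mem_polyFunctions {B : V → Matrix ι ι K}
    (hB : ∀ i j, (fun x => B x i j) ∈ polyFunctions K V) :
    (fun x => (B x).det) ∈ polyFunctions K V := by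
  let B' : Matrix ι ι (polyFunctions K V) := .of fun i j => ⟨_, hB i j⟩
  have hdet : (fun x => (B x).det) = B'.det := by
    ext x
    exact (RingHom.map_det ((Pi.evalRingHom _ x).comp (polyFunctions K V).val.toRingHom) B').symm
  exact hdet ▸ B'.det.2

theorem matrix_cramer_mem_polyFunctions {B : V → Matrix ι ι K}
    (hB : ∀ i j, (fun x => B x i j) ∈ polyFunctions K V) {y : V → ι → K}
    (hy : ∀ i, (fun x => y x i) ∈ polyFunctions K V) (k : ι) :
    (fun x => (B x).cramer (y x) k) ∈ polyFunctions K V := by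
  simp only [Matrix.cramer_apply]
  refine matrix_det_mem_polyFunctions fun i j => ?_
  by_cases hj : j = k
  · simpa only [hj, Matrix.updateCol_self] using hy i
  · simpa only [Matrix.updateCol_ne hj] using hB i j

end Determinants

namespace IsPolynomialMap

theorem toMatrix_mem_polyFunctions {C : V → Module.End K W} (hC : IsPolynomialMap K C)
    {ι : Type*} [Fintype ι] [DecidableEq ι] (b : Module.Basis ι K W) (i j : ι) :
    (fun x => LinearMap.toMatrix b b (C x) i j) ∈ polyFunctions K V := by
  simp only [LinearMap.toMatrix_apply]
  exact hC (b.coord i ∘ₗ LinearMap.applyₗ (b j))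

variable [FiniteDimensional K W]

theorem det_mem_polyFunctions {C : V → Module.End K W} (hC : IsPolynomialMap K C) :
    (fun x => LinearMap.det (C x)) ∈ polyFunctions K V := by
  let b := Module.finBasis K W
  simp only [← LinearMap.det_toMatrix b]
  exact matrix_det_mem_polyFunctions (hC.toMatrix_mem_polyFunctions b)

theorem exists_apply_eq_det_smul {C : V → Module.End K W} (hC : IsPolynomialMap K C)
    {y : V → W} (hy : IsPolynomialMap K y) :
    ∃ z : V → W, IsPolynomialMap K z ∧ ∀ x, C x (z x) = LinearMap.det (C x) • y x := by
  let b := Module.finBasis K W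
  let B := fun x => LinearMap.toMatrix b b (C x)
  refine ⟨fun x => b.equivFun.symm ((B x).cramer (b.equivFun (y x))), ?_, fun x => ?_⟩
  · simp only [Module.Basis.equivFun_symm_apply]
    exact .sum fun k _ => .smul (matrix_cramer_mem_polyFunctions
      (hC.toMatrix_mem_polyFunctions b) (fun i => hy (b.coord i)) k) (const _)
  · refine b.equivFun.injective ?_
    rw [map_smul, ← LinearMap.det_toMatrix b, ← Matrix.mulVec_cramer]
    refine (LinearMap.toMatrix_mulVec_repr b b (C x) _).symm.trans ?_
    exact congrArg (B x).mulVec (b.equivFun.apply_symm_apply _)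

theorem exists_mem_ker_deformation {U : Type*} [AddCommGroup U] [Module K U]
    {A : V → U →ₗ[K] W} (hA : IsPolynomialMap K A) {e : V} (he : Function.Surjective (A e))
    {v₀ : U} (hv₀ : A e v₀ = 0) :
    ∃ w : V → U, IsPolynomialMap K w ∧ w e = v₀ ∧ ∀ x, A x (w x) = 0 := by
  obtain ⟨s, hs⟩ := (A e).exists_rightInverse_of_surjective (LinearMap.range_eq_top.2 he)
  have hC : IsPolynomialMap K fun x => A x ∘ₗ s := hA.linearMap_comp (LinearMap.lcomp K W s)
  have hAv : IsPolynomialMap K fun x => A x v₀ := hA.linearMap_comp (LinearMap.applyₗ v₀)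
  obtain ⟨z, hz, hCz⟩ := hC.exists_apply_eq_det_smul hAv
  have hze : z e = 0 := by simpa [hs, hv₀] using hCz e
  refine ⟨fun x => LinearMap.det (A x ∘ₗ s) • v₀ - s (z x),
    (smul hC.det_mem_polyFunctions (const v₀)).sub (hz.linearMap_comp s), ?_, fun x => ?_⟩
  · simp only [hs, LinearMap.det_id, one_smul, hze, map_zero, sub_zero]
  · rw [map_sub, map_smul, sub_eq_zero]
    exact (hCz x).symm

end IsPolynomialMap

end PolynomialMaps

section ZariskiTopology

variable {K V : Type*} [Field K] [AddCommGroup V] [Module K V]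

theorem isTopologicalBasis_zariski :
    @TopologicalSpace.IsTopologicalBasis V (zariskiTopology K V)
      {U | ∃ p ∈ polyFunctions K V, U = {x | p x ≠ 0}} := by
  let := zariskiTopology K V
  refine TopologicalSpace.isTopologicalBasis_of_subbasis_of_finiteInter rfl ⟨?_, ?_⟩
  · exact ⟨1, one_mem _, by simp⟩
  · rintro _ ⟨p, hp, rfl⟩ _ ⟨q, hq, rfl⟩
    exact ⟨p * q, mul_mem hp hq, by ext x; simp⟩

theorem isOpen_zariski_iff {U : Set V} :
    IsOpen[zariskiTopology K V] U ↔
      ∀ x ∈ U, ∃ p ∈ polyFunctions K V, p x ≠ 0 ∧ ∀ y, p y ≠ 0 → y ∈ U := by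
  let := zariskiTopology K V
  rw [isTopologicalBasis_zariski.isOpen_iff]
  refine forall₂_congr fun x _ => ⟨?_, ?_⟩
  · rintro ⟨_, ⟨p, hp, rfl⟩, hx, hU⟩
    exact ⟨p, hp, hx, hU⟩
  · rintro ⟨p, hp, hx, hU⟩
    exact ⟨_, ⟨p, hp, rfl⟩, hx, hU⟩

theorem exists_eval_eq_of_mem_polyFunctions {p : K → K} (hp : p ∈ polyFunctions K K) :
    ∃ P : Polynomial K, ∀ t, P.eval t = p t := by
  suffices h : polyFunctions K K ≤ (Polynomial.aeval (id : K → K)).range by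
    obtain ⟨P, rfl⟩ := h hp
    exact ⟨P, fun t => by simp [Polynomial.aeval_fn_apply]⟩
  refine Algebra.adjoin_le ?_
  rintro _ ⟨l, rfl⟩
  exact ⟨.C (l 1) * .X, funext fun t => by simp⟩

theorem preirreducibleSpace_zariski [Infinite K] :
    @PreirreducibleSpace V (zariskiTopology K V) := by
  let := zariskiTopology K V
  refine .of_forall_nonempty_inter fun U U' hU hU' ⟨x, hx⟩ ⟨y, hy⟩ => ?_
  obtain ⟨p, hp, hpx, hpU⟩ := isOpen_zariski_iff.1 hU x hx
  obtain ⟨q, hq, hqy, hqU⟩ := isOpen_zariski_iff.1 hU' y hy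
  have hline : IsPolynomialMap K fun t : K => x - t • (x - y) :=
    (IsPolynomialMap.const x).sub (.of_linearMap (LinearMap.toSpanSingleton K V (x - y)))
  obtain ⟨P, hP⟩ := exists_eval_eq_of_mem_polyFunctions (hline.comp_mem_polyFunctions hp)
  obtain ⟨Q, hQ⟩ := exists_eval_eq_of_mem_polyFunctions (hline.comp_mem_polyFunctions hq)
  have hP0 : P ≠ 0 := by
    rintro rfl
    exact hpx (by simpa using (hP 0).symm)
  have hQ0 : Q ≠ 0 := by
    rintro rfl
    exact hqy (by simpa using (hQ 1).symm)
  obtain ⟨t, ht⟩ : ∃ t, (P * Q).eval t ≠ 0 := by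
    by_contra! h
    exact mul_ne_zero hP0 hQ0 (Polynomial.zero_of_eval_zero _ h)
  rw [Polynomial.eval_mul, hP, hQ] at ht
  exact ⟨_, hpU _ (left_ne_zero_of_mul ht), hqU _ (right_ne_zero_of_mul ht)⟩

end ZariskiTopology

section Extensions

variable {Λ : Type u} [Ring Λ] {R P M N : Type u} [AddCommGroup R] [Module Λ R] [AddCommGroup P]
  [Module Λ P] [AddCommGroup M] [Module Λ M] [AddCommGroup N] [Module Λ N]

open CategoryTheory CategoryTheory.Abelian in
theorem exists_comp_eq_of_subsingleton_extOne [hMN : Subsingleton (ExtOne Λ M N)] {i : R →ₗ[Λ] P}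
    {p : P →ₗ[Λ] M} (hi : Function.Injective i) (hp : Function.Surjective p)
    (hip : Function.Exact i p) (θ : R →ₗ[Λ] N) : ∃ u : P →ₗ[Λ] N, u ∘ₗ i = θ := by
  let T := ModuleCat.shortComplexOfCompEqZero i p hip.linearMap_comp_eq_zero
  have hT : T.ShortExact := ModuleCat.shortComplex_shortExact T hip hi hp
  obtain ⟨y, hy⟩ := Ext.contravariant_sequence_exact₁ hT (ModuleCat.of Λ N)
    (Ext.mk₀ (ModuleCat.ofHom θ)) (add_zero 1) (hMN.elim _ _)
  obtain ⟨u, rfl⟩ := Ext.addEquiv₀.symm.surjective y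
  refine ⟨u.hom, congrArg ModuleCat.Hom.hom (Ext.addEquiv₀.symm.injective ?_ : T.f ≫ u = _)⟩
  exact (Ext.mk₀_comp_mk₀ T.f u).symm.trans hy

end Extensions

section RestrictionOfScalars

variable {K : Type*} {Λ : Type*} [Field K] [Ring Λ] [Algebra K Λ] {X Y Z : Type*}
  [AddCommGroup X] [AddCommGroup Y] [AddCommGroup Z] [Module Λ X] [Module Λ Y] [Module Λ Z]
  [Module K X] [Module K Y] [Module K Z] [IsScalarTower K Λ X] [IsScalarTower K Λ Y]
  [IsScalarTower K Λ Z]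

theorem finite_linearMap_of_isScalarTower [Module.Finite K X] [Module.Finite K Y] :
    Module.Finite K (X →ₗ[Λ] Y) :=
  Module.Finite.of_injective (LinearMap.restrictScalarsₗ K Λ X Y K)
    (LinearMap.restrictScalars_injective K)

variable (K Λ X Y Z) in
/-- Composition of `Λ`-linear maps as a `K`-bilinear map, by which `u ↦ u ∘ f` depends linearly on
`f`. The bilinear map `LinearMap.llcomp` needs commutative coefficients. -/
def precompₗ : (X →ₗ[Λ] Y) →ₗ[K] (Y →ₗ[Λ] Z) →ₗ[K] X →ₗ[Λ] Z :=
  LinearMap.mk₂ K (fun f g => g ∘ₗ f)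
    (fun _ _ _ => LinearMap.comp_add _ _ _)
    (fun c f g => LinearMap.ext fun x => g.map_smul_of_tower c (f x))
    (fun _ _ _ => LinearMap.add_comp _ _ _)
    (fun _ _ _ => LinearMap.smul_comp _ _ _)

variable (K) in
theorem finrank_quotient_range_of_injective [Module.Finite K Y] {f : X →ₗ[Λ] Y}
    (hf : Function.Injective f) :
    Module.finrank K (Y ⧸ LinearMap.range f) = Module.finrank K Y - Module.finrank K X := by
  rw [Submodule.finrank_quotient,
    ← LinearMap.finrank_range_of_inj (f := f.restrictScalars K) hf]
  rfl

variable (K) in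
theorem nonempty_quotient_equiv_of_finrank_eq [Module.Finite K X] (N : Submodule Λ X)
    {w : X →ₗ[Λ] Y} (hw : Function.Surjective w) (hN : N ≤ LinearMap.ker w)
    (hdim : Module.finrank K (X ⧸ N) = Module.finrank K Y) : Nonempty ((X ⧸ N) ≃ₗ[Λ] Y) := by
  have : Module.Finite K Y := Module.Finite.of_surjective (w.restrictScalars K) hw
  have : Module.Finite K (X ⧸ N) :=
    Module.Finite.of_surjective (N.mkQ.restrictScalars K) N.mkQ_surjective
  have hsurj : Function.Surjective (N.liftQ w hN) :=
    LinearMap.range_eq_top.1 ((N.range_liftQ w hN).trans (LinearMap.range_eq_top.2 hw))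
  have hinj : Function.Injective ((N.liftQ w hN).restrictScalars K) :=
    (LinearMap.injective_iff_surjective_of_finrank_eq_finrank hdim).2 hsurj
  exact ⟨.ofBijective (N.liftQ w hN) ⟨hinj, hsurj⟩⟩

end RestrictionOfScalars

section OpenLoci

theorem IsPolynomialMap.isOpen_setOf_surjective {K V U W : Type*} [Field K] [AddCommGroup V]
    [Module K V] [AddCommGroup U] [Module K U] [AddCommGroup W] [Module K W]
    [FiniteDimensional K W] {w : V → U →ₗ[K] W} (hw : IsPolynomialMap K w) :
    IsOpen[zariskiTopology K V] {x | Function.Surjective (w x)} := by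
  refine isOpen_zariski_iff.2 fun e he => ?_
  obtain ⟨s, hs⟩ := (w e).exists_rightInverse_of_surjective (LinearMap.range_eq_top.2 he)
  refine ⟨fun x => LinearMap.det (w x ∘ₗ s),
    (hw.linearMap_comp (LinearMap.lcomp K W s)).det_mem_polyFunctions, ?_, fun x hx => ?_⟩
  · simp only [hs, LinearMap.det_id, ne_eq, one_ne_zero, not_false_eq_true]
  · exact .of_comp (LinearMap.equivOfDetNeZero (w x ∘ₗ s) hx).surjective

variable {K : Type v} {Λ : Type u} [Field K] [Ring Λ] [Algebra K Λ] {R P M : Type u}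
  [AddCommGroup R] [Module Λ R] [Module K R] [IsScalarTower K Λ R] [Module.Finite K R]
  [AddCommGroup P] [Module Λ P] [Module K P] [IsScalarTower K Λ P] [Module.Finite K P]
  [AddCommGroup M] [Module Λ M] [Module K M] [IsScalarTower K Λ M]

-- Rigidity makes `u ↦ u ∘ δ e` surjective onto `Hom(R, M)`, so that the projection `P → M` killing
-- `δ e` deforms to maps `w x : P → M` killing `δ x`; as long as these are surjective, they identify
-- `P ⧸ range (δ x)` with `M` by a dimension count.
theorem IsRigid.isOpen_setOf_nonempty_quotient_range_equiv (hM : IsRigid Λ M) {E : Type*}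
    [AddCommGroup E] [Module K E] {δ : E → R →ₗ[Λ] P} (hδ : IsPolynomialMap K δ)
    (hinj : ∀ x, Function.Injective (δ x)) :
    IsOpen[zariskiTopology K E] {x | Nonempty ((P ⧸ LinearMap.range (δ x)) ≃ₗ[Λ] M)} := by
  let := zariskiTopology K E
  refine isOpen_iff_forall_mem_open.2 fun e ⟨ε⟩ => ?_
  have hMδ : Subsingleton (ExtOne Λ M M) := hM
  let p : P →ₗ[Λ] M := ε.toLinearMap ∘ₗ (LinearMap.range (δ e)).mkQ
  have hp : Function.Surjective p := ε.surjective.comp (Submodule.mkQ_surjective _)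
  have hexact : Function.Exact (δ e) p := fun y => by simp [p]
  have : Module.Finite K M := Module.Finite.of_surjective (p.restrictScalars K) hp
  have : Module.Finite K (R →ₗ[Λ] M) := finite_linearMap_of_isScalarTower
  obtain ⟨w, hw, hwe, hwδ⟩ := (hδ.linearMap_comp (precompₗ K Λ R P M)).exists_mem_ker_deformation
    (exists_comp_eq_of_subsingleton_extOne (hinj e) hp hexact) hexact.linearMap_comp_eq_zero
  have hdim (x : E) : Module.finrank K (P ⧸ LinearMap.range (δ x)) = Module.finrank K M := by
    rw [← (ε.restrictScalars K).finrank_eq, finrank_quotient_range_of_injective K (hinj x),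
      finrank_quotient_range_of_injective K (hinj e)]
  refine ⟨{x | Function.Surjective (w x)}, fun x hx => ?_, ?_, ?_⟩
  · exact nonempty_quotient_equiv_of_finrank_eq K _ hx
      (LinearMap.range_le_ker_iff.2 (hwδ x)) (hdim x)
  · exact (hw.linearMap_comp (LinearMap.restrictScalarsₗ K Λ P M K)).isOpen_setOf_surjective
  · change Function.Surjective (w e)
    rwa [hwe]

end OpenLoci

theorem IsHereditaryRing.projective_submodule_of_span_singleton_eq_top {Λ : Type u} [Ring Λ]
    (hΛ : IsHereditaryRing Λ) {P : Type*} [AddCommGroup P] [Module Λ P] [Module.Projective Λ P]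
    {x : P} (hx : Submodule.span Λ {x} = ⊤) (N : Submodule Λ P) : Module.Projective Λ N := by
  obtain ⟨s, hs⟩ := (LinearMap.toSpanSingleton Λ P x).exists_rightInverse_of_surjective
    ((LinearMap.range_toSpanSingleton x).trans hx)
  have hinj : Function.Injective s := LinearMap.injective_of_comp_eq_id _ _ hs
  have := hΛ (N.map s)
  exact .of_equiv' (N.equivMapOfInjective s hinj).symm

namespace IsProjectiveCover

variable {Λ : Type u} [Ring Λ] {P S : Type u} [AddCommGroup P] [Module Λ P]
  [AddCommGroup S] [Module Λ S] [IsSimpleModule Λ S] {π : P →ₗ[Λ] S}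

theorem isCoatom_ker (hπ : IsProjectiveCover π) :
    IsCoatom (LinearMap.ker π) :=
  LinearMap.isCoatom_ker_of_surjective hπ.surjective

theorem le_ker_of_ne_top (hπ : IsProjectiveCover π) {N : Submodule Λ P}
    (hN : N ≠ ⊤) : N ≤ LinearMap.ker π := by
  by_contra h
  exact hN (hπ.superfluous N (hπ.isCoatom_ker.2 _ (right_lt_sup.2 h)))

theorem ker_eq_of_isCoatom (hπ : IsProjectiveCover π) {N : Submodule Λ P}
    (hN : IsCoatom N) : LinearMap.ker π = N :=
  (hN.le_iff_eq hπ.isCoatom_ker.1).1 (hπ.le_ker_of_ne_top hN.1)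

theorem jacobson_eq_ker (hπ : IsProjectiveCover π) :
    Module.jacobson Λ P = LinearMap.ker π :=
  le_antisymm (sInf_le hπ.isCoatom_ker) (le_sInf fun _ hN => (hπ.ker_eq_of_isCoatom hN).le)

theorem exists_span_singleton_eq_top (hπ : IsProjectiveCover π) :
    ∃ x : P, Submodule.span Λ {x} = ⊤ := by
  have := IsSimpleModule.nontrivial Λ S
  obtain ⟨s, hs⟩ := exists_ne (0 : S)
  obtain ⟨x, rfl⟩ := hπ.surjective s
  refine ⟨x, by_contra fun h => hs ?_⟩
  exact hπ.le_ker_of_ne_top h (Submodule.mem_span_singleton_self x)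

theorem finite (hπ : IsProjectiveCover π) : Module.Finite Λ P := by
  obtain ⟨x, hx⟩ := hπ.exists_span_singleton_eq_top
  exact ⟨⟨{x}, by rwa [Finset.coe_singleton]⟩⟩

theorem injective_of_projective_range (hπ : IsProjectiveCover π) {P' : Type*}
    [AddCommGroup P'] [Module Λ P'] {c : P →ₗ[Λ] P'} [Module.Projective Λ (LinearMap.range c)]
    (hc : c ≠ 0) : Function.Injective c := by
  obtain ⟨s, hs⟩ := c.rangeRestrict.exists_rightInverse_of_surjective c.range_rangeRestrict
  have hs' : Function.LeftInverse c.rangeRestrict s := fun y => congr($hs y)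
  have hker : LinearMap.ker c ≤ LinearMap.ker π :=
    hπ.le_ker_of_ne_top fun h => hc (LinearMap.ker_eq_top.1 h)
  have htop : LinearMap.range s = ⊤ := hπ.superfluous _ <| eq_top_iff.2 fun x _ => by
    rw [← add_sub_cancel (s (c.rangeRestrict x)) x]
    refine Submodule.add_mem_sup (LinearMap.mem_range_self _ _) (hker ?_)
    rw [← LinearMap.ker_rangeRestrict, LinearMap.sub_mem_ker_iff, hs']
  have hright := hs'.rightInverse_of_surjective (LinearMap.range_eq_top.1 htop)
  exact Subtype.val_injective.comp hright.injective

theorem bijective_of_ne_zero [IsArtinianRing Λ] (hΛ : IsHereditaryRing Λ)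
    (hπ : IsProjectiveCover π) {c : P →ₗ[Λ] P} (hc : c ≠ 0) : Function.Bijective c := by
  obtain ⟨x, hx⟩ := hπ.exists_span_singleton_eq_top
  have := hπ.finite
  have := hπ.projective
  have := hΛ.projective_submodule_of_span_singleton_eq_top hx (LinearMap.range c)
  exact IsArtinian.bijective_of_injective_endomorphism c (hπ.injective_of_projective_range hc)

theorem range_le_jacobson (hπ : IsProjectiveCover π) {P' S' : Type u}
    [AddCommGroup P'] [Module Λ P'] [AddCommGroup S'] [Module Λ S'] [IsSimpleModule Λ S']
    {π' : P' →ₗ[Λ] S'} (hπ' : IsProjectiveCover π') (hS : IsEmpty (S ≃ₗ[Λ] S'))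
    (c : P →ₗ[Λ] P') : LinearMap.range c ≤ Module.jacobson Λ P' := by
  rw [hπ'.jacobson_eq_ker, LinearMap.range_le_ker_iff]
  by_contra h
  have hs : Function.Surjective (π' ∘ₗ c) := LinearMap.surjective_of_ne_zero h
  have he := hπ.ker_eq_of_isCoatom (LinearMap.isCoatom_ker_of_surjective hs)
  exact hS.false ((LinearMap.quotKerEquivOfSurjective π hπ.surjective).symm.trans
    ((Submodule.quotEquivOfEq _ _ he).trans (LinearMap.quotKerEquivOfSurjective _ hs)))

end IsProjectiveCover

section HomOverEndomorphisms

theorem finite_linearMap_domMulAct_end (K : Type*) {Λ : Type*} [Field K] [Ring Λ]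
    [Algebra K Λ] {P M : Type*} [AddCommGroup P] [Module Λ P] [AddCommGroup M] [Module Λ M]
    [Module K P] [IsScalarTower K Λ P] [Module.Finite K P] [Module K M] [IsScalarTower K Λ M]
    [Module.Finite K M] : Module.Finite (Module.End Λ P)ᵈᵐᵃ (P →ₗ[Λ] M) := by
  let : Module K (Module.End Λ P)ᵈᵐᵃ := inferInstanceAs (Module K (Module.End Λ P)ᵐᵒᵖ)
  have : IsScalarTower K (Module.End Λ P)ᵈᵐᵃ (P →ₗ[Λ] M) :=
    ⟨fun k a h => LinearMap.ext fun y => h.map_smul_of_tower k (DomMulAct.mk.symm a y)⟩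
  have : Module.Finite K (P →ₗ[Λ] M) := finite_linearMap_of_isScalarTower
  exact Module.Finite.of_restrictScalars_finite K _ _

theorem exists_bijective_comp_of_finrank_eq {Λ : Type*} [Ring Λ] {P M : Type*} [AddCommGroup P]
    [Module Λ P] [AddCommGroup M] [Module Λ M] [Nontrivial P]
    (hP : ∀ c : Module.End Λ P, c ≠ 0 → Function.Bijective c)
    [Module.Finite (Module.End Λ P)ᵈᵐᵃ (P →ₗ[Λ] M)] {r : ℕ}
    (hr : Module.finrank (Module.End Λ P)ᵈᵐᵃ (P →ₗ[Λ] M) = r) :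
    ∃ p : (Fin r → P) →ₗ[Λ] M,
      Function.Bijective (p.comp : (P →ₗ[Λ] (Fin r → P)) → (P →ₗ[Λ] M)) := by
  have hunit (a : (Module.End Λ P)ᵈᵐᵃ) : IsUnit a ∨ a = 0 := by
    by_cases ha : DomMulAct.mk.symm a = 0
    · exact .inr (DomMulAct.mk.symm.injective ha)
    · exact .inl ((Module.End.isUnit_iff _).2 (hP _ ha)).op
  have : Nontrivial (Module.End Λ P)ᵈᵐᵃ := inferInstanceAs (Nontrivial (Module.End Λ P)ᵐᵒᵖ)
  let : DivisionRing (Module.End Λ P)ᵈᵐᵃ := .ofIsUnitOrEqZero hunit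
  let b : Module.Basis (Fin r) (Module.End Λ P)ᵈᵐᵃ (P →ₗ[Λ] M) := Module.finBasisOfFinrankEq _ _ hr
  let p : (Fin r → P) →ₗ[Λ] M := ∑ a, b a ∘ₗ LinearMap.proj a
  have hp (t : P →ₗ[Λ] (Fin r → P)) :
      p ∘ₗ t = b.equivFun.symm fun a => DomMulAct.mk (LinearMap.proj a ∘ₗ t) := by
    ext y
    simp [p, Module.Basis.equivFun_symm_apply, DomMulAct.mk_smul_linearMap_apply]
  refine ⟨p, fun t t' h => ?_, fun h => ?_⟩
  · rw [hp, hp] at h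
    exact LinearMap.ext fun y => funext fun a =>
      congr(DomMulAct.mk.symm ($(b.equivFun.symm.injective h) a) y)
  · refine ⟨LinearMap.pi fun a => DomMulAct.mk.symm (b.equivFun h a), ?_⟩
    exact (hp _).trans (b.equivFun.symm_apply_apply h)

end HomOverEndomorphisms

theorem surjective_comp_pi {Λ : Type*} [Ring Λ] {ι : Type*} [Finite ι] {Y : ι → Type*}
    [∀ i, AddCommGroup (Y i)] [∀ i, Module Λ (Y i)] {X M : Type*} [AddCommGroup X] [Module Λ X]
    [AddCommGroup M] [Module Λ M] {p : X →ₗ[Λ] M}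
    (hp : ∀ i, Function.Surjective (p.comp : (Y i →ₗ[Λ] X) → (Y i →ₗ[Λ] M))) :
    Function.Surjective (p.comp : (((i : ι) → Y i) →ₗ[Λ] X) → (((i : ι) → Y i) →ₗ[Λ] M)) := by
  classical
  have := Fintype.ofFinite ι
  intro θ
  choose t ht using fun i => hp i (θ ∘ₗ LinearMap.single Λ Y i)
  refine ⟨LinearMap.lsum Λ Y ℕ t, LinearMap.pi_ext fun i y => ?_⟩
  exact (congrArg p (LinearMap.lsum_piSingle _ _ ℕ t i y)).trans congr($(ht i) y)

namespace IsCompleteListOfSimples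

variable {Λ : Type u} [Ring Λ] {n : ℕ} {S P : Fin n → Type u} [∀ i, AddCommGroup (S i)]
  [∀ i, Module Λ (S i)] [∀ i, AddCommGroup (P i)] [∀ i, Module Λ (P i)]
  {π : (i : Fin n) → P i →ₗ[Λ] S i} {X : Type u} {Y : Type*} [AddCommGroup X] [Module Λ X]
  [AddCommGroup Y] [Module Λ Y]

theorem exists_hom_ne_zero (hS : IsCompleteListOfSimples Λ S)
    (hπ : ∀ i, IsProjectiveCover (π i)) [Module.Finite Λ X] [Nontrivial X] :
    ∃ (i : Fin n) (c : P i →ₗ[Λ] X), c ≠ 0 := by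
  obtain ⟨N, hN⟩ := IsCoatomic.exists_coatom (Submodule Λ X)
  have hsimple := isSimpleModule_iff_isCoatom.2 hN
  obtain ⟨i, ⟨e⟩⟩ := hS.exhaustive (X ⧸ N) hsimple
  have := (hπ i).projective
  have := hsimple.nontrivial
  obtain ⟨c, hc⟩ := Module.projective_lifting_property N.mkQ (e.symm.toLinearMap ∘ₗ π i)
    N.mkQ_surjective
  have hsurj : Function.Surjective (N.mkQ ∘ₗ c) := hc ▸ e.symm.surjective.comp (hπ i).surjective
  refine ⟨i, c, ?_⟩
  rintro rfl
  obtain ⟨y, hy⟩ := exists_ne (0 : X ⧸ N)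
  obtain ⟨z, rfl⟩ := hsurj y
  exact hy rfl

theorem surjective_of_surjective_comp (hS : IsCompleteListOfSimples Λ S)
    (hπ : ∀ i, IsProjectiveCover (π i)) [Module.Finite Λ X] {p : Y →ₗ[Λ] X}
    (hp : ∀ i, Function.Surjective (p.comp : (P i →ₗ[Λ] Y) → (P i →ₗ[Λ] X))) :
    Function.Surjective p := by
  by_contra h
  have := Submodule.Quotient.nontrivial_iff.2 (mt LinearMap.range_eq_top.1 h)
  obtain ⟨i, c, hc⟩ := hS.exists_hom_ne_zero hπ (X := X ⧸ LinearMap.range p)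
  have := (hπ i).projective
  obtain ⟨c', rfl⟩ := Module.projective_lifting_property (LinearMap.range p).mkQ c
    (Submodule.mkQ_surjective _)
  obtain ⟨t, rfl⟩ := hp i c'
  rw [← LinearMap.comp_assoc, LinearMap.range_mkQ_comp] at hc
  exact hc (LinearMap.zero_comp t)

theorem injective_of_injective_comp (hS : IsCompleteListOfSimples Λ S)
    (hπ : ∀ i, IsProjectiveCover (π i)) [IsNoetherian Λ X] {q : X →ₗ[Λ] Y}
    (hq : ∀ i, Function.Injective (q.comp : (P i →ₗ[Λ] X) → (P i →ₗ[Λ] Y))) :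
    Function.Injective q := by
  by_contra h
  have := Submodule.nontrivial_iff_ne_bot.2 (mt LinearMap.ker_eq_bot.1 h)
  obtain ⟨i, c, hc⟩ := hS.exists_hom_ne_zero hπ (X := LinearMap.ker q)
  have hqc : (LinearMap.ker q).subtype ∘ₗ c = 0 := hq i <| by
    rw [← LinearMap.comp_assoc, LinearMap.comp_ker_subtype, LinearMap.zero_comp,
      LinearMap.comp_zero]
  exact hc (LinearMap.ext fun y => Subtype.ext congr($hqc y))

end IsCompleteListOfSimples

section RepresentationSpace

variable {K : Type v} {Λ : Type u} [Field K] [Ring Λ] [Algebra K Λ] {n : ℕ}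
  {P : Fin n → Type u} [∀ i, AddCommGroup (P i)] [∀ i, Module Λ (P i)]
  [∀ i, Module K (P i)] [∀ i, IsScalarTower K Λ (P i)]
  {d : Fin n → Fin n → ℕ} {α : Fin n → ℕ}
  {φ : (j : Fin n) → ((i : Fin n) → Fin (d j i) → P i) ≃ₗ[Λ] Module.jacobson Λ (P j)}
  {f : radProjSum Λ P α →ₗ[Λ] ProjSum P α} {M : Type u} [AddCommGroup M] [Module Λ M]

variable (K) in
theorem finrank_lt_finrank_of_linearEquiv_jacobson {i j : Fin n} [Module.Finite K (P j)]
    [Nontrivial (P j)] (e : ((i : Fin n) → Fin (d j i) → P i) ≃ₗ[Λ] Module.jacobson Λ (P j))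
    (hd : 0 < d j i) : Module.finrank K (P i) < Module.finrank K (P j) := by
  have : Module.Finite Λ (P j) := .of_restrictScalars_finite K Λ _
  let c : P i →ₗ[Λ] Module.jacobson Λ (P j) := e.toLinearMap ∘ₗ
    LinearMap.single Λ (fun i => Fin (d j i) → P i) i ∘ₗ
      LinearMap.single Λ (fun _ : Fin (d j i) => P i) ⟨0, hd⟩
  have hc : Function.Injective (c.restrictScalars K) :=
    e.injective.comp <| (Pi.single_injective (M := fun i => Fin (d j i) → P i) i).comp
      (Pi.single_injective (M := fun _ : Fin (d j i) => P i) ⟨0, hd⟩)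
  have hlt : (Module.jacobson Λ (P j)).restrictScalars K < ⊤ := Module.jacobson_lt_top Λ (P j)
  calc Module.finrank K (P i)
    _ ≤ Module.finrank K ((Module.jacobson Λ (P j)).restrictScalars K) :=
      LinearMap.finrank_le_finrank_of_injective hc
    _ < Module.finrank K (P j) := Submodule.finrank_lt hlt.ne

theorem repSpace_apply_eq_zero (hf : f ∈ repSpace K α φ) {x : radProjSum Λ P α} {i : Fin n}
    (hx : ∀ j, 0 < d j i → x.1 j = 0) : f x i = 0 := by
  obtain ⟨g, hg⟩ := hf
  obtain ⟨x, rfl⟩ := (radIso α φ).surjective x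
  have hfx : g i (fun j a => x j a i) = f (radIso α φ x) i := congr($hg x i)
  have hxi : (fun j a => x j a i : RadSumPart P d α i) = 0 := by
    ext j a k
    have hφ : φ j (x j a) = 0 := Subtype.ext (congrFun (hx j k.pos) a)
    rw [(φ j).map_eq_zero_iff.1 hφ]
    rfl
  rw [← hfx, hxi, map_zero]

variable (K) in
theorem exists_mem_repSpace_comp_eq {p : ProjSum P α →ₗ[Λ] M}
    (hp : ∀ i, Function.Surjective
      ((p ∘ₗ LinearMap.single Λ _ i).comp : (P i →ₗ[Λ] (Fin (α i) → P i)) → (P i →ₗ[Λ] M)))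
    (θ : radProjSum Λ P α →ₗ[Λ] M) : ∃ f ∈ repSpace K α φ, p ∘ₗ f = θ := by
  let ι (i : Fin n) : RadSumPart P d α i →ₗ[Λ] RadSum P d α :=
    LinearMap.pi fun j => LinearMap.pi fun a =>
      LinearMap.single Λ _ i ∘ₗ LinearMap.proj a ∘ₗ LinearMap.proj j
  have hι (x : RadSum P d α) : ∑ i, ι i (fun j a => x j a i) = x := by
    ext j a : 2
    simp only [ι, Finset.sum_apply]
    exact Finset.univ_sum_single (x j a)
  have hpart (i : Fin n) : Function.Surjective ((p ∘ₗ LinearMap.single Λ _ i).comp :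
      (RadSumPart P d α i →ₗ[Λ] (Fin (α i) → P i)) → (RadSumPart P d α i →ₗ[Λ] M)) :=
    surjective_comp_pi fun _ => surjective_comp_pi fun _ => surjective_comp_pi fun _ => hp i
  choose g hg using fun i => hpart i (θ ∘ₗ (radIso α φ).toLinearMap ∘ₗ ι i)
  let f := blockDiagonal K Λ P d α g ∘ₗ (radIso α φ).symm.toLinearMap
  refine ⟨f, ⟨g, LinearMap.ext fun x => by simp [f]⟩, LinearMap.ext fun x => ?_⟩
  obtain ⟨x, rfl⟩ := (radIso α φ).surjective x
  calc p (f (radIso α φ x))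
    _ = p (blockDiagonal K Λ P d α g x) := by simp [f]
    _ = ∑ i, p (LinearMap.single Λ _ i (g i fun j a => x j a i)) := by
      rw [← map_sum]
      exact congrArg p (Finset.univ_sum_single _).symm
    _ = ∑ i, θ (radIso α φ (ι i fun j a => x j a i)) :=
      Finset.sum_congr rfl fun i _ => congr($(hg i) _)
    _ = θ (radIso α φ x) := by rw [← map_sum, ← map_sum, hι]

variable [∀ i, Module.Finite K (P i)]

-- A nonzero component `x i` with `P i` of maximal dimension is impossible, since `f x i` only
-- depends on components `x j` with `P j` of larger dimension.
theorem eq_zero_of_repSpace_apply_eq (hf : f ∈ repSpace K α φ) {x : radProjSum Λ P α}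
    (hx : ∀ i, x.1 i ≠ 0 → f x i = x.1 i) : x = 0 := by
  by_contra hne
  have hsupp : {i | x.1 i ≠ 0}.Nonempty := by
    by_contra! h
    exact hne (Subtype.ext (funext fun i => not_not.1 (Set.eq_empty_iff_forall_notMem.1 h i)))
  obtain ⟨i, hi, hmax⟩ := Set.exists_max_image _ (fun i => Module.finrank K (P i))
    (Set.toFinite _) hsupp
  refine hi ((hx i hi).symm.trans (repSpace_apply_eq_zero hf fun j hd => ?_))
  by_contra hj
  obtain ⟨a, ha⟩ := Function.ne_iff.1 hj
  have : Nontrivial (P j) := ⟨_, _, ha⟩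
  exact (finrank_lt_finrank_of_linearEquiv_jacobson K (φ j) hd).not_ge (hmax j hj)

theorem injective_sub_subtype_of_mem_repSpace (hf : f ∈ repSpace K α φ) :
    Function.Injective (f - (radProjSum Λ P α).subtype) :=
  (injective_iff_map_eq_zero _).2 fun _ hx =>
    eq_zero_of_repSpace_apply_eq hf fun i _ => congrFun (sub_eq_zero.1 hx) i

theorem IsRigid.isOpen_isoLocus (hM : IsRigid Λ M) :
    IsOpen[zariskiTopology K (repSpace K α φ)] (isoLocus K φ M) := by
  let : Module K M := Module.compHom M (algebraMap K Λ)
  have : IsScalarTower K Λ M := IsScalarTower.of_compHom K Λ M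
  have : Module.Finite K (radProjSum Λ P α) :=
    .of_injective ((radProjSum Λ P α).subtype.restrictScalars K) Subtype.val_injective
  have hsub : IsPolynomialMap K (repSpace K α φ).subtype := .of_linearMap _
  have hδ := hsub.sub (.const (radProjSum Λ P α).subtype)
  exact hM.isOpen_setOf_nonempty_quotient_range_equiv hδ fun f =>
    injective_sub_subtype_of_mem_repSpace f.2

variable (K) in
/-- The part of `c : Pᵢ → P(α)` outside the block `Pᵢ^{αᵢ}`, as a map to `rad P(α)`, so that it
can be composed with maps on `rad P(α)`. Its values lie in `rad P(α)` as soon as all maps `Pᵢ → Pⱼ`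
with `j ≠ i` have values in `rad Pⱼ`. -/
def eraseBlock (i : Fin n)
    (hi : ∀ j ≠ i, ∀ c : P i →ₗ[Λ] P j, LinearMap.range c ≤ Module.jacobson Λ (P j)) :
    (P i →ₗ[Λ] ProjSum P α) →ₗ[K] (P i →ₗ[Λ] radProjSum Λ P α) where
  toFun c := (c - LinearMap.single Λ _ i ∘ₗ LinearMap.proj i ∘ₗ c).codRestrict _ fun y => by
    refine (mem_jacobson_pi_iff Λ _ _).2 fun j => (mem_jacobson_pi_iff Λ _ _).2 fun a => ?_
    obtain rfl | hj := eq_or_ne j i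
    · simp
    · simpa [hj] using hi j hj (LinearMap.proj a ∘ₗ LinearMap.proj j ∘ₗ c) ⟨y, rfl⟩
  map_add' c c' := by
    ext y : 2
    simp [add_sub_add_comm, Pi.single_add]
  map_smul' k c := by
    ext y : 2
    simp [smul_sub, Pi.single_smul]

-- With `ρ c` the part of `c` outside the block, the map `c ↦ c - f ∘ ρ c` is injective, hence
-- surjective by finite dimensionality, and differs from `-(f - inc) ∘ ρ c` by a map to the block.
theorem exists_eq_single_comp_add (hf : f ∈ repSpace K α φ) {i : Fin n}
    (hi : ∀ j ≠ i, ∀ c : P i →ₗ[Λ] P j, LinearMap.range c ≤ Module.jacobson Λ (P j))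
    (c : P i →ₗ[Λ] ProjSum P α) :
    ∃ (t : P i →ₗ[Λ] (Fin (α i) → P i)) (r : P i →ₗ[Λ] radProjSum Λ P α),
      c = LinearMap.single Λ _ i ∘ₗ t + (f - (radProjSum Λ P α).subtype) ∘ₗ r := by
  let ρ := eraseBlock K (α := α) i hi
  let Ψ : Module.End K (P i →ₗ[Λ] ProjSum P α) := LinearMap.id - f.compRight K ∘ₗ ρ
  have hρ (c : P i →ₗ[Λ] ProjSum P α) :
      (radProjSum Λ P α).subtype ∘ₗ ρ c = c - LinearMap.single Λ _ i ∘ₗ LinearMap.proj i ∘ₗ c :=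
    rfl
  have hΨ : Function.Injective Ψ := (injective_iff_map_eq_zero Ψ).2 fun c hc => by
    have hc : c = f ∘ₗ ρ c := sub_eq_zero.1 hc
    have hρc : ρ c = 0 := LinearMap.ext fun y => eq_zero_of_repSpace_apply_eq hf fun j hj => by
      have hji : j ≠ i := by
        rintro rfl
        exact hj (by simpa using congr($(hρ c) y j))
      exact congr($hc y j).symm.trans (by simpa [hji] using congr($(hρ c) y j).symm)
    rw [hc, hρc, LinearMap.comp_zero]
  have : Module.Finite K (P i →ₗ[Λ] ProjSum P α) := finite_linearMap_of_isScalarTower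
  obtain ⟨c, rfl⟩ := LinearMap.surjective_of_injective hΨ c
  refine ⟨LinearMap.proj i ∘ₗ c, -ρ c, ?_⟩
  rw [LinearMap.comp_neg, LinearMap.sub_comp, hρ]
  change c - f ∘ₗ ρ c = _
  abel

variable {S : Fin n → Type u} [∀ i, AddCommGroup (S i)] [∀ i, Module Λ (S i)]
  {π : (i : Fin n) → P i →ₗ[Λ] S i}

theorem IsCompleteListOfSimples.range_le_jacobson (hS : IsCompleteListOfSimples Λ S)
    (hπ : ∀ i, IsProjectiveCover (π i)) {i j : Fin n} (hij : j ≠ i) (c : P i →ₗ[Λ] P j) :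
    LinearMap.range c ≤ Module.jacobson Λ (P j) :=
  have := hS.simple
  (hπ i).range_le_jacobson (hπ j) ⟨fun e => hij (hS.eq_of_iso i j ⟨e⟩).symm⟩ c

theorem nonempty_repCoker_equiv_of_bijective_comp (hS : IsCompleteListOfSimples Λ S)
    (hπ : ∀ i, IsProjectiveCover (π i)) [Module.Finite Λ M] (hf : f ∈ repSpace K α φ)
    {p : ProjSum P α →ₗ[Λ] M} (hpf : p ∘ₗ f = p ∘ₗ (radProjSum Λ P α).subtype)
    (hp : ∀ i, Function.Bijective
      ((p ∘ₗ LinearMap.single Λ _ i).comp : (P i →ₗ[Λ] (Fin (α i) → P i)) → (P i →ₗ[Λ] M))) :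
    Nonempty (repCoker f ≃ₗ[Λ] M) := by
  have hsurj : Function.Surjective p := hS.surjective_of_surjective_comp hπ fun i c => by
    obtain ⟨t, ht⟩ := (hp i).surjective c
    exact ⟨LinearMap.single Λ _ i ∘ₗ t, ht⟩
  let δ := f - (radProjSum Λ P α).subtype
  have hpδ : p ∘ₗ δ = 0 := by rw [LinearMap.comp_sub, hpf, sub_self]
  let q : repCoker f →ₗ[Λ] M := (LinearMap.range δ).liftQ p (LinearMap.range_le_ker_iff.2 hpδ)
  have hqsurj : Function.Surjective q :=
    .of_comp (g := (LinearMap.range δ).mkQ) hsurj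
  have : IsNoetherian Λ (ProjSum P α) := isNoetherian_of_tower K inferInstance
  have hqinj : Function.Injective q := hS.injective_of_injective_comp hπ fun i => by
    refine (injective_iff_map_eq_zero (q.compRight ℕ)).2 fun c hc => ?_
    have := (hπ i).projective
    obtain ⟨c, rfl⟩ := Module.projective_lifting_property (LinearMap.range δ).mkQ c
      (Submodule.mkQ_surjective _)
    obtain ⟨t, r, rfl⟩ := exists_eq_single_comp_add hf
      (fun j hj => hS.range_le_jacobson hπ hj) c
    have ht : t = 0 := (hp i).injective <| calc (p ∘ₗ LinearMap.single Λ _ i) ∘ₗ t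
      _ = p ∘ₗ (LinearMap.single Λ _ i ∘ₗ t + δ ∘ₗ r) := by
        rw [LinearMap.comp_add, ← LinearMap.comp_assoc r, hpδ, LinearMap.zero_comp, add_zero,
          LinearMap.comp_assoc]
      _ = 0 := hc
      _ = (p ∘ₗ LinearMap.single Λ _ i) ∘ₗ 0 := (LinearMap.comp_zero _).symm
    rw [ht, LinearMap.comp_zero, zero_add, ← LinearMap.comp_assoc, LinearMap.range_mkQ_comp,
      LinearMap.zero_comp]
  exact ⟨.ofBijective q ⟨hqinj, hqsurj⟩⟩

theorem nonempty_isoLocus [Module.Finite K Λ] (hΛ : IsHereditaryRing Λ)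
    (hS : IsCompleteListOfSimples Λ S) (hπ : ∀ i, IsProjectiveCover (π i)) [Module.Finite Λ M]
    (hdim : dimVector Λ P M = α) : (isoLocus K (α := α) φ M).Nonempty := by
  have := hS.simple
  have : IsArtinianRing Λ := IsArtinianRing.of_finite K Λ
  let : Module K M := Module.compHom M (algebraMap K Λ)
  have : IsScalarTower K Λ M := IsScalarTower.of_compHom K Λ M
  have : Module.Finite K M := Module.Finite.trans Λ M
  have hblock (i : Fin n) : ∃ p : (Fin (α i) → P i) →ₗ[Λ] M,
      Function.Bijective (p.comp : (P i →ₗ[Λ] (Fin (α i) → P i)) → (P i →ₗ[Λ] M)) := by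
    have := (hS.simple i).nontrivial
    have := (hπ i).surjective.nontrivial
    have := finite_linearMap_domMulAct_end K (Λ := Λ) (P := P i) (M := M)
    exact exists_bijective_comp_of_finrank_eq (fun _ => (hπ i).bijective_of_ne_zero hΛ)
      (congrFun hdim i)
  choose p hp using hblock
  let q : ProjSum P α →ₗ[Λ] M := LinearMap.lsum Λ _ ℕ p
  have hq (i : Fin n) : q ∘ₗ LinearMap.single Λ _ i = p i :=
    LinearMap.ext (LinearMap.lsum_piSingle _ _ ℕ p i)
  simp only [← hq] at hp
  obtain ⟨f, hf, hqf⟩ := exists_mem_repSpace_comp_eq K (fun i => (hp i).surjective)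
    (q ∘ₗ (radProjSum Λ P α).subtype)
  exact ⟨⟨f, hf⟩, nonempty_repCoker_equiv_of_bijective_comp hS hπ hf hqf hp⟩

end RepresentationSpace

theorem theorem2p1p6 {K : Type v} {Λ : Type u} [Field K] [Infinite K] [Ring Λ] [Algebra K Λ]
    [Module.Finite K Λ] (hΛ : IsHereditaryRing Λ) {n : ℕ}
    -- the simple modules `S₁, …, Sₙ`
    (S : Fin n → Type u) [∀ i, AddCommGroup (S i)] [∀ i, Module Λ (S i)]
    (hS : IsCompleteListOfSimples Λ S)
    -- their projective covers `P₁, …, Pₙ`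
    (P : Fin n → Type u) [∀ i, AddCommGroup (P i)] [∀ i, Module Λ (P i)]
    [∀ i, Module K (P i)] [∀ i, IsScalarTower K Λ (P i)]
    (π : (i : Fin n) → P i →ₗ[Λ] S i) (hπ : ∀ i, IsProjectiveCover (π i))
    -- a choice of decompositions of the radicals
    (φ : (j : Fin n) →
      ((i : Fin n) → Fin (extDim Λ S j i) → P i) ≃ₗ[Λ] Module.jacobson Λ (P j))
    (α : Fin n → ℕ)
    (M : Type u) [AddCommGroup M] [Module Λ M] [Module.Finite Λ M]
    (hM : IsRigid Λ M) (hdim : dimVector Λ P M = α) :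
    IsOpen[zariskiTopology K (repSpace K α φ)] (isoLocus K φ M) ∧
    @Dense _ (zariskiTopology K (repSpace K α φ)) (isoLocus K φ M) ∧
    -- the generic representation is determined by `α`: it is the only module whose isomorphism
    -- class is open and dense, and the only rigid module of dimension vector `α`
    (∀ (N : Type u) [AddCommGroup N] [Module Λ N],
      IsOpen[zariskiTopology K (repSpace K α φ)] (isoLocus K φ N) →
      @Dense _ (zariskiTopology K (repSpace K α φ)) (isoLocus K φ N) →
      Nonempty (N ≃ₗ[Λ] M)) ∧
    (∀ (N : Type u) [AddCommGroup N] [Module Λ N] [Module.Finite Λ N],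
      IsRigid Λ N → dimVector Λ P N = α → Nonempty (N ≃ₗ[Λ] M)) := by
  have := hS.simple
  have (i : Fin n) := (hπ i).finite
  have (i : Fin n) : Module.Finite K (P i) := Module.Finite.trans Λ _
  let := zariskiTopology K (repSpace K α φ)
  have := preirreducibleSpace_zariski (K := K) (V := repSpace K α φ)
  have hopen : IsOpen (isoLocus K (α := α) φ M) := hM.isOpen_isoLocus
  have hne : (isoLocus K (α := α) φ M).Nonempty := nonempty_isoLocus hΛ hS hπ hdim
  have hdense : Dense (isoLocus K (α := α) φ M) := hopen.dense hne
  refine ⟨hopen, hdense, fun N _ _ _ hNdense => ?_, fun N _ _ _ hN hNdim => ?_⟩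
  · obtain ⟨f, ⟨eM⟩, ⟨eN⟩⟩ := hNdense.inter_open_nonempty _ hopen hne
    exact ⟨eN.symm.trans eM⟩
  · obtain ⟨f, ⟨eN⟩, ⟨eM⟩⟩ := hdense.inter_open_nonempty _ hN.isOpen_isoLocus
      (nonempty_isoLocus hΛ hS hπ hNdim)
    exact ⟨eN.symm.trans eM⟩
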